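/- Let $T$ be a (nondegenerate) tetrahedron in $\mathbb{R}^3$, and suppose that, for a suitable numbering $V_1,V_2,V_3,V_4$ of its vertices, its edge lengths $d_{ij}=|V_iV_j|$ satisfy one of the following, where different letters denote different lengths: - type (g): $(d_{12},d_{13},d_{14},d_{23},d_{24},d_{34})=(a,b,c,c,b,a)$; - type (p): $(d_{12},d_{13},d_{14},d_{23},d_{24},d_{34})=(a,c,b,b,d,a)$; - type (w): $(d_{12},d_{13},d_{14},d_{23},d_{24},d_{34})=(b,a,c,d,a,e)$; - type (y): $(d_{12},d_{13},d_{14},d_{23},d_{24},d_{34})=(a,b,c,d,e,f)$. Then $T$ does not tile space face-to-face. That is, there is no collection of tetrahedra, each the image of $T$ under an isometry of $\mathbb{R}^3$ (reflections allowed), that covers $\mathbb{R}^3$ and in which any two distinct tetrahedra have disjoint interiors and meet in a common face (the empty set, a vertex, an edge or a triangular face) of both. -/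

import Mathlib

/-- Euclidean three-space. -/
abbrev Space3 : Type := EuclideanSpace ℝ (Fin 3)

/-- A (nondegenerate) tetrahedron in three-space with labelled vertices: four affinely independent
points. -/
abbrev Tetrahedron : Type := Affine.Simplex ℝ Space3 3

namespace Tetrahedron

/-- The solid tetrahedron: the convex hull of its four vertices. -/
def body (T : Tetrahedron) : Set Space3 := convexHull ℝ (Set.range T.points)

/-- `F` is a face of `T` of some dimension: the empty set, a vertex, an edge, a triangular face, or
the whole solid. These are the convex hulls of the sets of vertices. -/
def IsFace (T : Tetrahedron) (F : Set Space3) : Prop :=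
  ∃ I : Set (Fin 4), F = convexHull ℝ (T.points '' I)

/-- `S` is a copy of `T` under an isometry of space. The isometry need not preserve orientation,
so mirror images are copies. -/
def IsCopy (T S : Tetrahedron) : Prop :=
  ∃ g : Space3 ≃ᵃⁱ[ℝ] Space3, ∀ i, S.points i = g (T.points i)

/-- `𝒯` is a face-to-face tiling of space by copies of `T`: the tiles are copies of `T`, they
cover space, distinct tiles have disjoint interiors, and distinct tiles meet in a common face
(which may be empty). Since interiors are disjoint, no solid occurs twice with its vertices
labelled in different ways. -/
structure IsFaceToFaceTiling (T : Tetrahedron) (𝒯 : Set Tetrahedron) : Prop where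
  copies : ∀ S ∈ 𝒯, T.IsCopy S
  covers : ⋃ S ∈ 𝒯, S.body = Set.univ
  disjoint_interiors : ∀ S ∈ 𝒯, ∀ S' ∈ 𝒯, S ≠ S' → Disjoint (interior S.body) (interior S'.body)
  face_to_face : ∀ S ∈ 𝒯, ∀ S' ∈ 𝒯, S ≠ S' →
    S.IsFace (S.body ∩ S'.body) ∧ S'.IsFace (S.body ∩ S'.body)

/-- `T` tiles space face-to-face. -/
def TilesFaceToFace (T : Tetrahedron) : Prop :=
  ∃ 𝒯 : Set Tetrahedron, T.IsFaceToFaceTiling 𝒯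

/-- For a suitable numbering `V₁, V₂, V₃, V₄` of the vertices of `T`, the lengths of the edges
`V₁V₂, V₁V₃, V₁V₄, V₂V₃, V₂V₄, V₃V₄` are the given numbers. -/
def HasEdgeLengths (T : Tetrahedron) (d₁₂ d₁₃ d₁₄ d₂₃ d₂₄ d₃₄ : ℝ) : Prop :=
  ∃ σ : Equiv.Perm (Fin 4),
    dist (T.points (σ 0)) (T.points (σ 1)) = d₁₂ ∧
    dist (T.points (σ 0)) (T.points (σ 2)) = d₁₃ ∧
    dist (T.points (σ 0)) (T.points (σ 3)) = d₁₄ ∧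
    dist (T.points (σ 1)) (T.points (σ 2)) = d₂₃ ∧
    dist (T.points (σ 1)) (T.points (σ 3)) = d₂₄ ∧
    dist (T.points (σ 2)) (T.points (σ 3)) = d₃₄

/-- Type (g): opposite edges are equal, with three distinct lengths. -/
def IsTypeG (T : Tetrahedron) : Prop :=
  ∃ a b c : ℝ, [a, b, c].Nodup ∧ T.HasEdgeLengths a b c c b a

/-- Type (p): two pairs of opposite edges are equal, with four distinct lengths in all. -/
def IsTypeP (T : Tetrahedron) : Prop :=
  ∃ a b c d : ℝ, [a, b, c, d].Nodup ∧ T.HasEdgeLengths a c b b d a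

/-- Type (w): one pair of opposite edges is equal, with five distinct lengths in all. -/
def IsTypeW (T : Tetrahedron) : Prop :=
  ∃ a b c d e : ℝ, [a, b, c, d, e].Nodup ∧ T.HasEdgeLengths b a c d a e

/-- Type (y): all six edge lengths are distinct. -/
def IsTypeY (T : Tetrahedron) : Prop :=
  ∃ a b c d e f : ℝ, [a, b, c, d, e, f].Nodup ∧ T.HasEdgeLengths a b c d e f

end Tetrahedron

/-! In all four types, edges with a common vertex have different lengths, and congruent faces
correspond under symmetries of the tetrahedron. Hence the neighbour of a tile across a face can only
be its mirror image in that face (`mem_relabelings_of_mirror`), and the reflections in two faces at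
an edge generate a group that carries the tile to tiles (`moved_mem_relabelings`). A mirror of this
group that cuts the interior of the tile would map the tile to itself and swap two vertices, which
makes a face isosceles (`mul_nonneg_of_refl_mem`). So the dihedral angles behave like integral parts
of a straight angle, as in a Euclidean Coxeter simplex (`submultipleAngle`).

Such a simplex cannot be scalene (`Coxeter.not_scalene`). The negated inner products of the face
normals are nonnegative conductances on a network with four vertices, positive exactly where two
faces are not perpendicular. Triangles are excluded by the arithmetic-geometric mean inequality;
stars, paths and four-cycles force two equal edges at a vertex; the remaining networks contradict
the independence of the normals. -/

namespace Tetrahedron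

/-! ### Barycentric coordinates, faces and renumberings -/

/-- The vertices of a tetrahedron as an affine basis of space. -/
noncomputable def basis (T : Tetrahedron) : AffineBasis (Fin 4) ℝ Space3 :=
  ⟨T.points, T.independent,
    (T.independent.affineSpan_eq_top_iff_card_eq_finrank_add_one).2 (by simp)⟩

@[simp]
theorem basis_apply (T : Tetrahedron) (i : Fin 4) : T.basis i = T.points i := rfl

theorem coord_points (T : Tetrahedron) (i j : Fin 4) :
    T.basis.coord i (T.points j) = if i = j then 1 else 0 :=
  T.basis.coord_apply i j

theorem mem_body {T : Tetrahedron} {x : Space3} :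
    x ∈ T.body ↔ ∀ i, 0 ≤ T.basis.coord i x := by
  change x ∈ convexHull ℝ (Set.range T.basis) ↔ _
  rw [T.basis.convexHull_eq_nonneg_coord]
  rfl

theorem mem_interior_body {T : Tetrahedron} {x : Space3} :
    x ∈ interior T.body ↔ ∀ i, 0 < T.basis.coord i x := by
  change x ∈ interior (convexHull ℝ (Set.range T.basis)) ↔ _
  rw [T.basis.interior_convexHull]
  rfl

theorem points_mem_body (T : Tetrahedron) (i : Fin 4) : T.points i ∈ T.body :=
  subset_convexHull ℝ _ (Set.mem_range_self i)

theorem isCompact_body (T : Tetrahedron) : IsCompact T.body :=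
  (Set.finite_range T.points).isCompact_convexHull (𝕜 := ℝ)

/-- The same tetrahedron with its vertices renumbered. -/
noncomputable def relabel (T : Tetrahedron) (σ : Equiv.Perm (Fin 4)) : Tetrahedron := T.reindex σ.symm

@[simp]
theorem relabel_points (T : Tetrahedron) (σ : Equiv.Perm (Fin 4)) (i : Fin 4) :
    (T.relabel σ).points i = T.points (σ i) := rfl

theorem body_relabel (T : Tetrahedron) (σ : Equiv.Perm (Fin 4)) :
    (T.relabel σ).body = T.body := by
  simp only [body, relabel, Affine.Simplex.reindex_range_points]

theorem coord_eq_zero_of_mem_face {T : Tetrahedron} {I : Set (Fin 4)} {x : Space3}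
    (hx : x ∈ convexHull ℝ (T.points '' I)) {i : Fin 4} (hi : i ∉ I) :
    T.basis.coord i x = 0 := by
  have hc : Convex ℝ ((T.basis.coord i) ⁻¹' {0}) :=
    (convex_singleton (0 : ℝ)).affine_preimage _
  refine convexHull_min ?_ hc hx
  rintro _ ⟨j, hj, rfl⟩
  have : i ≠ j := fun h => hi (h ▸ hj)
  simp [coord_points, this]

/-- The point with prescribed barycentric coordinates. -/
theorem exists_coord_eq (T : Tetrahedron) (w : Fin 4 → ℝ) (hw : ∑ i, w i = 1) :
    ∃ x, ∀ i, T.basis.coord i x = w i :=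
  ⟨Finset.univ.affineCombination ℝ T.basis w, fun i =>
    T.basis.coord_apply_combination_of_mem (Finset.mem_univ i) hw⟩

theorem interior_body_nonempty (T : Tetrahedron) : (interior T.body).Nonempty := by
  obtain ⟨x, hx⟩ := T.exists_coord_eq (fun _ => 1 / 4) (by simp)
  exact ⟨x, mem_interior_body.2 fun i => by rw [hx]; norm_num⟩

theorem eq_points_of_coord_eq_one {T : Tetrahedron} {x : Space3} (hx : x ∈ T.body) {i : Fin 4}
    (hi : T.basis.coord i x = 1) : x = T.points i := by
  refine T.basis.ext_elem fun j => ?_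
  rw [coord_points]
  split_ifs with h
  · rw [h, hi]
  · have hsum := T.basis.sum_coord_apply_eq_one x
    rw [← Finset.add_sum_erase _ _ (Finset.mem_univ i), hi] at hsum
    have h0 : ∑ k ∈ Finset.univ.erase i, T.basis.coord k x = 0 := by linarith
    exact (Finset.sum_eq_zero_iff_of_nonneg fun k _ => mem_body.1 hx k).1 h0 j
      (by simp [h])

theorem coord_le_one {T : Tetrahedron} {x : Space3} (hx : x ∈ T.body) (i : Fin 4) :
    T.basis.coord i x ≤ 1 := by
  rw [← T.basis.sum_coord_apply_eq_one x]
  exact Finset.single_le_sum (f := fun j => T.basis.coord j x)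
    (fun k _ => mem_body.1 hx k) (Finset.mem_univ i)

theorem points_mem_extremePoints (T : Tetrahedron) (i : Fin 4) :
    T.points i ∈ T.body.extremePoints ℝ := by
  refine mem_extremePoints_iff_left.2 ⟨T.points_mem_body i, fun x hx y hy hxy => ?_⟩
  obtain ⟨a, b, ha, hb, hab, h⟩ := hxy
  have hc : T.basis.coord i (a • x + b • y) = a * T.basis.coord i x + b * T.basis.coord i y := by
    simpa using Convex.combo_affine_apply (f := T.basis.coord i) (x := x) (y := y) hab
  rw [h, coord_points, if_pos rfl] at hc
  have h1 := coord_le_one hx i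
  have h2 := coord_le_one hy i
  refine (eq_points_of_coord_eq_one hx ?_)
  nlinarith

/-- A face, as a set, determines its vertices; this turns a common face of two tiles into a matching
of their vertices. -/
theorem extremePoints_face (T : Tetrahedron) (I : Set (Fin 4)) :
    (convexHull ℝ (T.points '' I)).extremePoints ℝ = T.points '' I := by
  refine extremePoints_convexHull_subset.antisymm ?_
  rintro _ ⟨i, hi, rfl⟩
  refine inter_extremePoints_subset_extremePoints_of_subset
    (convexHull_mono (Set.image_subset_range _ _)) ⟨?_, T.points_mem_extremePoints i⟩
  exact subset_convexHull ℝ _ ⟨i, hi, rfl⟩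

/-! ### Gradients of the barycentric coordinates -/

/-- The gradient of the `i`-th barycentric coordinate, an inward normal to the face opposite to
the `i`-th vertex. -/
noncomputable def grad (T : Tetrahedron) (i : Fin 4) : Space3 :=
  (InnerProductSpace.toDual ℝ Space3).symm
    (LinearMap.toContinuousLinearMap (T.basis.coord i).linear)

theorem inner_grad (T : Tetrahedron) (i : Fin 4) (x y : Space3) :
    inner ℝ (T.grad i) (x - y) = T.basis.coord i x - T.basis.coord i y := by
  rw [grad, InnerProductSpace.toDual_symm_apply]
  exact (T.basis.coord i).linearMap_vsub x y

theorem inner_grad_points (T : Tetrahedron) (i j k : Fin 4) :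
    inner ℝ (T.grad i) (T.points j - T.points k) =
      (if i = j then 1 else 0) - (if i = k then 1 else 0) := by
  rw [inner_grad, coord_points, coord_points]

theorem ext_inner_grad (T : Tetrahedron) {u v : Space3}
    (h : ∀ i, inner ℝ (T.grad i) u = inner ℝ (T.grad i) v) : u = v := by
  have : u + T.points 0 = v + T.points 0 := by
    refine T.basis.ext_elem fun i => ?_
    have h1 := T.inner_grad i (u + T.points 0) (T.points 0)
    have h2 := T.inner_grad i (v + T.points 0) (T.points 0)
    rw [add_sub_cancel_right] at h1 h2
    linarith [h i]
  exact add_right_cancel this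

theorem sum_grad (T : Tetrahedron) : ∑ i, T.grad i = 0 := by
  refine ext_inner_left ℝ fun v => ?_
  rw [inner_zero_right, inner_sum]
  have h : ∀ i, inner ℝ v (T.grad i) = T.basis.coord i (v + T.points 0) -
      T.basis.coord i (T.points 0) := fun i => by
    rw [← inner_grad, add_sub_cancel_right, real_inner_comm]
  simp_rw [h, Finset.sum_sub_distrib, T.basis.sum_coord_apply_eq_one, sub_self]

/-- A vector orthogonal to a face is a multiple of the gradient. -/
theorem eq_smul_grad (T : Tetrahedron) (i : Fin 4) {u : Space3}
    (h : ∀ j k, j ≠ i → k ≠ i → inner ℝ u (T.points j - T.points k) = 0) :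
    ∃ t : ℝ, u = t • T.grad i := by
  obtain ⟨j, hj⟩ := exists_ne i
  refine ⟨inner ℝ u (T.points i - T.points j), ?_⟩
  have key : ∀ k, inner ℝ u (T.points k - T.points j) =
      inner ℝ (inner ℝ u (T.points i - T.points j) • T.grad i) (T.points k - T.points j) := by
    intro k
    rw [real_inner_smul_left, inner_grad_points, if_neg hj.symm]
    by_cases hk : i = k
    · simp [hk]
    · simp [hk, h k j (Ne.symm hk) hj]
  refine ext_inner_right ℝ fun v => ?_
  have hv : v = ∑ k, T.basis.coord k (v + T.points j) • (T.points k - T.points j) := by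
    have := T.basis.linear_combination_coord_eq_self (v + T.points j)
    simp only [smul_sub, Finset.sum_sub_distrib, ← Finset.sum_smul,
      T.basis.sum_coord_apply_eq_one, one_smul]
    simp only [basis_apply] at this
    rw [this, add_sub_cancel_right]
  rw [hv, inner_sum, inner_sum]
  exact Finset.sum_congr rfl fun k _ => by rw [real_inner_smul_right, real_inner_smul_right, key k]

theorem grad_ne_zero (T : Tetrahedron) (i : Fin 4) : T.grad i ≠ 0 := by
  intro h
  obtain ⟨j, hj⟩ := exists_ne i
  have := T.inner_grad_points i i j
  simp [h, hj.symm] at this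

/-- Two points different from the vertex `i` and at the same distances as it from the other
vertices coincide: both are the mirror image of the vertex. -/
theorem eq_of_dist_eq (T : Tetrahedron) (i : Fin 4) {x y : Space3}
    (hx : ∀ j, j ≠ i → dist x (T.points j) = dist (T.points i) (T.points j))
    (hy : ∀ j, j ≠ i → dist y (T.points j) = dist (T.points i) (T.points j))
    (hxi : x ≠ T.points i) (hyi : y ≠ T.points i) : x = y := by
  have main : ∀ z, (∀ j, j ≠ i → dist z (T.points j) = dist (T.points i) (T.points j)) →
      z ≠ T.points i → z = T.points i - (2 / inner ℝ (T.grad i) (T.grad i)) • T.grad i := by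
    intro z hz hzi
    have hsq : ∀ j, j ≠ i → inner ℝ (z - T.points i) (z - T.points i) +
        2 * inner ℝ (z - T.points i) (T.points i - T.points j) = 0 := by
      intro j hj
      have := hz j hj
      rw [dist_eq_norm, dist_eq_norm] at this
      have h2 : ‖z - T.points j‖ ^ 2 = ‖T.points i - T.points j‖ ^ 2 := by rw [this]
      rw [show z - T.points j = (z - T.points i) + (T.points i - T.points j) by abel,
        norm_add_sq_real, ← real_inner_self_eq_norm_sq] at h2
      linarith
    -- Differences of the equations `hsq` show that the displacement is orthogonal to the face. Its
    -- multiple `t` of the gradient then solves a quadratic equation with one nonzero root.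
    obtain ⟨t, ht⟩ := T.eq_smul_grad i (u := z - T.points i) (by
      intro j k hj hk
      have h1 := hsq j hj
      have h2 := hsq k hk
      rw [show T.points j - T.points k =
        (T.points i - T.points k) - (T.points i - T.points j) by abel, inner_sub_right]
      linarith)
    have ht0 : t ≠ 0 := by
      rintro rfl
      rw [zero_smul, sub_eq_zero] at ht
      exact hzi ht
    obtain ⟨j, hj⟩ := exists_ne i
    have h1 := hsq j hj
    rw [ht, real_inner_smul_left, real_inner_smul_right, real_inner_smul_left,
      inner_grad_points, if_pos rfl, if_neg hj.symm] at h1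
    have hg : inner ℝ (T.grad i) (T.grad i) ≠ 0 := inner_self_ne_zero.2 (T.grad_ne_zero i)
    have ht' : t = -(2 / inner ℝ (T.grad i) (T.grad i)) := by
      field_simp
      have : t * (t * inner ℝ (T.grad i) (T.grad i) + 2) = 0 := by linarith
      rcases mul_eq_zero.1 this with h | h
      · exact absurd h ht0
      · linarith
    rw [← sub_add_cancel z (T.points i), ht, ht', neg_smul]
    abel
  rw [main x hx hxi, main y hy hyi]

theorem IsCopy.dist_eq {T S : Tetrahedron} (h : T.IsCopy S) (i j : Fin 4) :
    dist (S.points i) (S.points j) = dist (T.points i) (T.points j) := by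
  obtain ⟨g, hg⟩ := h
  rw [hg, hg, g.dist_map]

/-! ### Local finiteness and neighbours across faces -/

/-- All copies of a tetrahedron contain balls of a common radius and lie in concentric balls of
another common radius. -/
theorem exists_ball_subset_subset_closedBall (T : Tetrahedron) :
    ∃ r > 0, ∃ R : ℝ, ∀ S, T.IsCopy S →
      ∃ c, Metric.ball c r ⊆ interior S.body ∧ S.body ⊆ Metric.closedBall c R := by
  obtain ⟨c, hc⟩ := T.interior_body_nonempty
  obtain ⟨r, hr, hball⟩ := Metric.isOpen_iff.1 isOpen_interior c hc
  obtain ⟨R, hR⟩ := T.isCompact_body.isBounded.subset_closedBall c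
  refine ⟨r, hr, R, ?_⟩
  rintro S ⟨g, hg⟩
  have hbody : S.body = g '' T.body := by
    have h := AffineMap.image_convexHull g.toAffineEquiv.toAffineMap (Set.range T.points)
    have hS : S.points = g ∘ T.points := funext hg
    rw [body, body, hS, Set.range_comp]
    exact h.symm
  refine ⟨g c, interior_maximal ?_ Metric.isOpen_ball, ?_⟩
  · rw [hbody]
    refine (g.toIsometryEquiv.image_ball c r).symm.subset.trans ?_
    exact Set.image_mono (hball.trans interior_subset)
  · rw [hbody]
    refine Set.Subset.trans ?_ (g.toIsometryEquiv.image_closedBall c R).subset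
    exact Set.image_mono hR

/-- Tiles near `x` contain disjoint balls of one radius inside a fixed ball, so volume bounds their
number. -/
theorem IsFaceToFaceTiling.finite_near {T : Tetrahedron} {𝒯 : Set Tetrahedron}
    (h : T.IsFaceToFaceTiling 𝒯) (x : Space3) :
    {S ∈ 𝒯 | (S.body ∩ Metric.closedBall x 1).Nonempty}.Finite := by
  obtain ⟨r, hr, R, hrR⟩ := T.exists_ball_subset_subset_closedBall
  set F := {S ∈ 𝒯 | (S.body ∩ Metric.closedBall x 1).Nonempty} with hF
  choose c hc using fun S : F => hrR S (h.copies S S.2.1)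
  have hsub : (⋃ S : F, Metric.ball (c S) r) ⊆ Metric.closedBall x (1 + R + r) := by
    refine Set.iUnion_subset fun S y hy => ?_
    obtain ⟨z, hz, hzx⟩ := S.2.2
    have h1 := (hc S).2 hz
    rw [Metric.mem_closedBall] at *
    rw [Metric.mem_ball] at hy
    have h2 := dist_triangle4 y (c S) z x
    rw [dist_comm (c S) z] at h2
    linarith
  have hfin := MeasureTheory.Measure.finite_const_le_meas_of_disjoint_iUnion
    (MeasureTheory.volume : MeasureTheory.Measure Space3)
    (Metric.measure_ball_pos MeasureTheory.volume (0 : Space3) hr)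
    (As := fun S : F => Metric.ball (c S) r) (fun _ => measurableSet_ball)
    (fun S S' hne => (h.disjoint_interiors S S.2.1 S' S'.2.1
      (fun e => hne (Subtype.ext e))).mono (hc S).1 (hc S').1)
    (ne_top_of_le_ne_top (MeasureTheory.measure_closedBall_lt_top (x := x) (r := 1 + R + r)).ne
      (MeasureTheory.measure_mono hsub))
  have huniv : {S : F | MeasureTheory.volume (Metric.ball (0 : Space3) r) ≤
      MeasureTheory.volume (Metric.ball (c S) r)} = Set.univ :=
    Set.eq_univ_of_forall fun S =>
      (MeasureTheory.Measure.addHaar_ball_center MeasureTheory.volume (c S) r).ge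
  rw [huniv] at hfin
  exact Set.finite_coe_iff.1 (Set.finite_univ_iff.1 hfin)

/-- Behind every face of a tile there is another tile with the same three vertices. -/
theorem IsFaceToFaceTiling.exists_adjacent {T : Tetrahedron} {𝒯 : Set Tetrahedron}
    (h : T.IsFaceToFaceTiling 𝒯) {S : Tetrahedron} (hS : S ∈ 𝒯) (i : Fin 4) :
    ∃ S' ∈ 𝒯, S' ≠ S ∧ ∃ π : Equiv.Perm (Fin 4), ∀ j, j ≠ i → S'.points (π j) = S.points j := by
  -- The centroid of the face opposite to vertex `i`.
  obtain ⟨x, hx⟩ := S.exists_coord_eq (fun j => if j = i then 0 else 1 / 3) (by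
    fin_cases i <;> simp [Fin.sum_univ_four] <;> norm_num)
  -- a tile other than `S` contains `x`
  obtain ⟨S', hS', hne, hxS'⟩ : ∃ S' ∈ 𝒯, S' ≠ S ∧ x ∈ S'.body := by
    set F := {S' ∈ 𝒯 | (S'.body ∩ Metric.closedBall x 1).Nonempty} \ {S} with hF
    have hFfin : F.Finite := (h.finite_near x).subset Set.sdiff_subset
    have hclosed : IsClosed (⋃ S' ∈ F, S'.body) :=
      hFfin.isClosed_biUnion fun S' _ => S'.isCompact_body.isClosed
    -- At negative parameters `t` the `i`-th coordinate is `t`, so the line is outside `S` and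
    -- covered by the other tiles. Finitely many of these matter, so their union is closed and
    -- contains the limit `x`.
    let γ : ℝ → Space3 := fun t => AffineMap.lineMap x (S.points i) t
    have hγ : Filter.Tendsto γ (nhdsWithin 0 (Set.Iio 0)) (nhds x) := by
      have hcont : Continuous γ := AffineMap.lineMap_continuous
      have h0 : γ 0 = x := AffineMap.lineMap_apply_zero _ _
      have := hcont.tendsto 0
      rw [h0] at this
      exact this.mono_left nhdsWithin_le_nhds
    have hmem : ∀ᶠ t in nhdsWithin (0 : ℝ) (Set.Iio 0), γ t ∈ ⋃ S' ∈ F, S'.body := by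
      filter_upwards [hγ (Metric.closedBall_mem_nhds x one_pos), self_mem_nhdsWithin] with t ht1 ht0
      have hcov : γ t ∈ ⋃ S ∈ 𝒯, S.body := h.covers ▸ Set.mem_univ _
      simp only [Set.mem_iUnion] at hcov ⊢
      obtain ⟨S', hS', hmem⟩ := hcov
      refine ⟨S', ⟨⟨hS', γ t, hmem, ht1⟩, ?_⟩, hmem⟩
      rintro rfl
      have h1 := mem_body.1 hmem i
      have h2 : S'.basis.coord i (γ t) = t := by
        simp only [γ, AffineMap.apply_lineMap, hx, coord_points]
        simp [AffineMap.lineMap_apply]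
      rw [h2] at h1
      exact absurd ht0 (not_lt.2 h1)
    have hxF := hclosed.mem_of_tendsto hγ hmem
    simp only [Set.mem_iUnion] at hxF
    obtain ⟨S', hS', hmem⟩ := hxF
    exact ⟨S', hS'.1.1, hS'.2, hmem⟩
  have hxS : x ∈ S.body := mem_body.2 fun j => by rw [hx]; split_ifs <;> norm_num
  obtain ⟨⟨I, hI⟩, ⟨J, hJ⟩⟩ := h.face_to_face S hS S' hS' hne.symm
  -- The coordinates of `x` other than the `i`-th are positive, so the common face needs all three
  -- vertices.
  have hIi : ∀ j, j ≠ i → j ∈ I := by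
    intro j hj
    by_contra hjI
    have h1 : x ∈ convexHull ℝ (S.points '' I) := hI ▸ ⟨hxS, hxS'⟩
    have h2 := coord_eq_zero_of_mem_face h1 hjI
    rw [hx, if_neg hj] at h2
    norm_num at h2
  have himage : S.points '' I = S'.points '' J := by
    rw [← extremePoints_face S I, ← extremePoints_face S' J, ← hI, ← hJ]
  have hex : ∀ j, ∃ k, j ≠ i → S'.points k = S.points j := by
    intro j
    by_cases hj : j = i
    · exact ⟨j, fun h => absurd hj h⟩
    · have : S.points j ∈ S'.points '' J := himage ▸ ⟨j, hIi j hj, rfl⟩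
      obtain ⟨k, -, hk⟩ := this
      exact ⟨k, fun _ => hk⟩
  choose f hf using hex
  obtain ⟨g, hg⟩ := Set.MapsTo.exists_equiv_extend_of_card_eq (α := Fin 4)
    (t := (Finset.univ : Finset (Fin 4))) (by simp) (s := {i}ᶜ) (f := f)
    (fun _ _ => Finset.mem_coe.2 (Finset.mem_univ _)) (by
      intro j hj k hk hjk
      apply S.independent.injective
      rw [← hf j hj, ← hf k hk, hjk])
  refine ⟨S', hS', hne, g.trans (Equiv.subtypeUnivEquiv Finset.mem_univ), fun j hj => ?_⟩
  rw [← hf j hj, ← hg j hj]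
  rfl

/-! ### Face rigidity and mirror images of tiles -/

/-- Any two congruent faces of `T` correspond under a symmetry of `T`: a renumbering of the
vertices that preserves the edge lengths of one face preserves all edge lengths. -/
def FaceRigid (T : Tetrahedron) : Prop :=
  ∀ (π : Equiv.Perm (Fin 4)) (i : Fin 4),
    (∀ j k, j ≠ i → k ≠ i → j ≠ k →
      dist (T.points (π j)) (T.points (π k)) = dist (T.points j) (T.points k)) →
    ∀ j k, j ≠ k → dist (T.points (π j)) (T.points (π k)) = dist (T.points j) (T.points k)

/-- All renumberings of the tiles of a collection. -/
def relabelings (𝒯 : Set Tetrahedron) : Set Tetrahedron :=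
  {S | ∃ S₀ ∈ 𝒯, ∃ σ : Equiv.Perm (Fin 4), S = S₀.relabel σ}

/-- In a tiling by copies of a face rigid tetrahedron, the mirror image of a tile in one of its
faces is a tile. -/
theorem IsFaceToFaceTiling.mem_relabelings_of_mirror {T : Tetrahedron} {𝒯 : Set Tetrahedron}
    (h : T.IsFaceToFaceTiling 𝒯) (hT : T.FaceRigid) {P Q : Tetrahedron}
    (hP : P ∈ relabelings 𝒯) (i : Fin 4) (hPQ : ∀ j, j ≠ i → Q.points j = P.points j)
    (hdist : ∀ j, j ≠ i →
      dist (Q.points i) (Q.points j) = dist (P.points i) (P.points j))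
    (hne : Q.points i ≠ P.points i) : Q ∈ relabelings 𝒯 := by
  obtain ⟨S, hS, σ, rfl⟩ := hP
  obtain ⟨S', hS', hne', π, hπ⟩ := h.exists_adjacent hS (σ i)
  have hdS := (h.copies S hS).dist_eq
  have hdS' := (h.copies S' hS').dist_eq
  have hrigid := hT π (σ i) (fun j k hj hk _ => by
    rw [← hdS j k, ← hdS' (π j) (π k), hπ j hj, hπ k hk])
  -- If the fourth vertices agreed, the two tiles would have the same body, against disjoint
  -- interiors.
  have hne'' : S'.points (π (σ i)) ≠ S.points (σ i) := by
    intro heq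
    have hpts : S.points = S'.points ∘ π := by
      funext j
      by_cases hj : j = σ i
      · rw [hj, Function.comp_apply, heq]
      · exact (hπ j hj).symm
    have hb : S.body = S'.body := by
      rw [body, body, hpts, EquivLike.range_comp]
    have hd := h.disjoint_interiors S hS S' hS' hne'.symm
    rw [← hb, disjoint_self] at hd
    exact S.interior_body_nonempty.ne_empty hd
  refine ⟨S', hS', σ.trans π, ?_⟩
  have hi : Q.points i = S'.points (π (σ i)) := by
    refine S.eq_of_dist_eq (σ i) ?_ ?_ hne hne''
    · intro j hj
      obtain ⟨k, rfl⟩ := σ.surjective j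
      have hk : k ≠ i := fun e => hj (e ▸ rfl)
      have := hdist k hk
      rw [hPQ k hk] at this
      exact this
    · intro j hj
      rw [← hπ j hj, hdS', hrigid _ _ hj.symm, ← hdS, hπ j hj]
  apply Affine.Simplex.ext
  intro j
  by_cases hj : j = i
  · rw [hj, hi]; rfl
  · rw [hPQ j hj]
    exact (hπ (σ j) (fun e => hj (σ.injective e))).symm

/-- Tiles with overlapping interiors agree up to the numbering of the vertices. -/
theorem IsFaceToFaceTiling.exists_eq_relabel {T : Tetrahedron} {𝒯 : Set Tetrahedron}
    (h : T.IsFaceToFaceTiling 𝒯) {P Q : Tetrahedron} (hP : P ∈ relabelings 𝒯)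
    (hQ : Q ∈ relabelings 𝒯) {x : Space3} (hxP : x ∈ interior P.body)
    (hxQ : x ∈ interior Q.body) : ∃ σ, Q = P.relabel σ := by
  obtain ⟨S, hS, σ, rfl⟩ := hP
  obtain ⟨S', hS', τ, rfl⟩ := hQ
  rw [body_relabel] at hxP hxQ
  have : S = S' := by
    by_contra hne
    exact Set.disjoint_left.1 (h.disjoint_interiors S hS S' hS' hne) hxP hxQ
  subst this
  refine ⟨τ.trans σ.symm, ?_⟩
  apply Affine.Simplex.ext
  intro j
  simp

/-! ### Reflections and the group at an edge -/

/-- The reflection in the plane through the origin orthogonal to `v`. -/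
noncomputable def refl (v : Space3) : Space3 ≃ₗᵢ[ℝ] Space3 := (Submodule.span ℝ {v})ᗮ.reflection

theorem refl_apply (v x : Space3) :
    refl v x = x - (2 * (inner ℝ v x / inner ℝ v v)) • v := by
  rw [refl, Submodule.reflection_orthogonal_apply, Submodule.reflection_singleton_apply,
    real_inner_self_eq_norm_sq, mul_smul, two_smul, two_smul]
  simp only [RCLike.ofReal_real_eq_id, id]
  abel

theorem refl_smul {v : Space3} {t : ℝ} (ht : t ≠ 0) : refl (t • v) = refl v := by
  simp only [refl, Submodule.span_singleton_smul_eq (IsUnit.mk0 t ht)]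

theorem refl_of_inner_eq_zero {v x : Space3} (h : inner ℝ v x = 0) : refl v x = x := by
  simp [refl_apply, h]

theorem refl_mul_self (v : Space3) : refl v * refl v = 1 :=
  Submodule.reflection_mul_reflection _

theorem refl_conj (L : Space3 ≃ₗᵢ[ℝ] Space3) (v : Space3) :
    refl (L v) = L * refl v * L⁻¹ := by
  ext1 x
  have h : inner ℝ (L v) x = inner ℝ v (L⁻¹ x) := by
    conv_lhs => rw [← L.apply_symm_apply x, L.inner_map_map]
    rfl
  have hx : L (L⁻¹ x) = x := L.apply_symm_apply x
  simp only [LinearIsometryEquiv.coe_mul, Function.comp_apply, refl_apply, map_sub, map_smul, hx,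
    L.inner_map_map, h]

/-- The image of a tetrahedron under the isometry with linear part `L` that fixes `p`. -/
noncomputable def moved (T : Tetrahedron) (p : Space3) (L : Space3 ≃ₗᵢ[ℝ] Space3) : Tetrahedron :=
  T.map (((AffineIsometryEquiv.vaddConst ℝ p).symm.trans
    L.toAffineIsometryEquiv).trans (AffineIsometryEquiv.vaddConst ℝ p)).toAffineEquiv.toAffineMap
    (AffineIsometryEquiv.injective _)

theorem moved_points (T : Tetrahedron) (p : Space3) (L : Space3 ≃ₗᵢ[ℝ] Space3) (i : Fin 4) :
    (T.moved p L).points i = L (T.points i - p) + p := rfl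

theorem moved_one (T : Tetrahedron) (p : Space3) : T.moved p 1 = T := by
  apply Affine.Simplex.ext
  intro j
  simp [moved_points]

/-- Affine maps preserve barycentric coordinates. Thus an interior point on a mirror is also
interior to the reflected tile. -/
theorem coord_moved (T : Tetrahedron) (p : Space3) (L : Space3 ≃ₗᵢ[ℝ] Space3) (x : Space3)
    (i : Fin 4) : (T.moved p L).basis.coord i (L (x - p) + p) = T.basis.coord i x := by
  obtain ⟨w, hw, hx⟩ : ∃ w : Fin 4 → ℝ, ∑ i, w i = 1 ∧ ∑ i, w i • T.points i = x :=
    ⟨_, T.basis.sum_coord_apply_eq_one x, T.basis.linear_combination_coord_eq_self x⟩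
  have key : ∀ S : Tetrahedron, S.basis.coord i (∑ i, w i • S.points i) = w i := by
    intro S
    rw [← Finset.univ.affineCombination_eq_linear_combination S.points w hw]
    exact S.basis.coord_apply_combination_of_mem (Finset.mem_univ i) hw
  have h : L (x - p) + p = ∑ i, w i • (T.moved p L).points i := by
    simp only [moved_points, smul_add, Finset.sum_add_distrib, ← Finset.sum_smul, hw, one_smul,
      ← map_smul, ← map_sum, smul_sub, Finset.sum_sub_distrib, hx]
  rw [h, key, ← hx, key]

/-- The reflections in the two faces at an edge generate isometries that map a tile to tiles. -/
theorem IsFaceToFaceTiling.moved_mem_relabelings {T : Tetrahedron} {𝒯 : Set Tetrahedron}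
    (h : T.IsFaceToFaceTiling 𝒯) (hT : T.FaceRigid) {P : Tetrahedron} (hP : P ∈ relabelings 𝒯)
    {i j k : Fin 4} (hki : k ≠ i) (hkj : k ≠ j) {L : Space3 ≃ₗᵢ[ℝ] Space3}
    (hL : L ∈ Subgroup.closure {refl (P.grad i), refl (P.grad j)}) :
    P.moved (P.points k) L ∈ relabelings 𝒯 := by
  -- Multiplying on the right by the reflection in a face of `P` replaces the moved tile by its
  -- mirror image in its own `m`-th face, so rigidity applies to words of any length.
  have step : ∀ m, k ≠ m → ∀ L, P.moved (P.points k) L ∈ relabelings 𝒯 →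
      P.moved (P.points k) (L * refl (P.grad m)) ∈ relabelings 𝒯 := by
    intro m hkm L hL
    have hfix : ∀ n, n ≠ m → (P.moved (P.points k) (L * refl (P.grad m))).points n =
        (P.moved (P.points k) L).points n := by
      intro n hn
      rw [moved_points, moved_points, LinearIsometryEquiv.coe_mul, Function.comp_apply,
        refl_of_inner_eq_zero]
      rw [inner_grad_points, if_neg hn.symm, if_neg hkm.symm, sub_zero]
    have hdist : ∀ (L : Space3 ≃ₗᵢ[ℝ] Space3) (a b : Fin 4),
        dist ((P.moved (P.points k) L).points a) ((P.moved (P.points k) L).points b) =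
          dist (P.points a) (P.points b) := by
      intro L a b
      rw [moved_points, moved_points, dist_add_right, L.dist_map, dist_sub_right]
    refine h.mem_relabelings_of_mirror hT hL m hfix (fun n _ => by rw [hdist, hdist]) ?_
    intro heq
    rw [moved_points, moved_points, LinearIsometryEquiv.coe_mul, Function.comp_apply] at heq
    have h1 := L.injective (add_right_cancel heq)
    rw [refl_apply, sub_eq_self, inner_grad_points, if_pos rfl, if_neg hkm.symm, smul_eq_zero] at h1
    have hg := P.grad_ne_zero m
    have hgg : inner ℝ (P.grad m) (P.grad m) ≠ 0 := inner_self_ne_zero.2 hg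
    rcases h1 with h1 | h1
    · simp [hg] at h1
    · exact hg h1
  induction hL using Subgroup.closure_induction_right with
  | one => rwa [moved_one]
  | mul_right x hx y hy ih =>
    rcases hy with rfl | rfl
    · exact step i hki x ih
    · exact step j hkj x ih
  | mul_inv_cancel x hx y hy ih =>
    have hinv : ∀ v, (refl v)⁻¹ = refl v := fun v => inv_eq_of_mul_eq_one_left (refl_mul_self v)
    rcases hy with rfl | rfl
    · rw [hinv]; exact step i hki x ih
    · rw [hinv]; exact step j hkj x ih

/-! ### Mirrors do not cut scalene tiles -/

/-- Any two edges with a common vertex have different lengths. -/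
def Scalene (T : Tetrahedron) : Prop :=
  ∀ i j k : Fin 4, i ≠ j → i ≠ k → j ≠ k →
    dist (T.points i) (T.points j) ≠ dist (T.points i) (T.points k)

theorem mem_relabelings {𝒯 : Set Tetrahedron} {P : Tetrahedron} (hP : P ∈ 𝒯) :
    P ∈ relabelings 𝒯 :=
  ⟨P, hP, 1, rfl⟩

/-- No mirror of the group generated by the reflections in the two faces at an edge of a tile
enters the interior of the tile. -/
theorem IsFaceToFaceTiling.mul_nonneg_of_refl_mem {T : Tetrahedron} {𝒯 : Set Tetrahedron}
    (h : T.IsFaceToFaceTiling 𝒯) (hT : T.FaceRigid) {P : Tetrahedron} (hP : P ∈ 𝒯)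
    (hPs : P.Scalene) {i j k l : Fin 4} (hij : i ≠ j) (hki : k ≠ i) (hkj : k ≠ j) (hli : l ≠ i)
    (hlj : l ≠ j) (hkl : k ≠ l) {α β : ℝ}
    (hL : refl (α • P.grad i + β • P.grad j) ∈
      Subgroup.closure {refl (P.grad i), refl (P.grad j)}) : 0 ≤ α * β := by
  by_contra! hneg
  set v := α • P.grad i + β • P.grad j with hv
  set s := P.points k with hs
  have hQ := h.moved_mem_relabelings hT (mem_relabelings hP) hki hkj hL
  have huniv : ∀ f : Fin 4 → ℝ, ∑ m, f m = f i + f j + f k + f l := by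
    intro f
    have : (Finset.univ : Finset (Fin 4)) = {i, j, k, l} := by
      symm
      rw [← Finset.card_eq_iff_eq_univ]
      simp [Finset.card_insert_of_notMem, hij, hki.symm, hkj.symm, hli.symm, hlj.symm, hkl]
    rw [this]
    simp [Finset.sum_insert, hij, hki.symm, hkj.symm, hli.symm, hlj.symm, hkl]
    ring
  -- an interior point of the tile on the mirror
  have hα : α ≠ 0 := by rintro rfl; simp at hneg
  have hβ : β ≠ 0 := by rintro rfl; simp at hneg
  have hα' := abs_pos.2 hα
  have hβ' := abs_pos.2 hβ
  -- The weights `|β| / D` and `|α| / D` add up to `1 / 2`, and since `α` and `β` have opposite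
  -- signs they cancel in `inner ℝ v (x - s)`.
  set D := 2 * (|α| + |β|) with hD
  have hDpos : 0 < D := by positivity
  obtain ⟨x, hx⟩ := P.exists_coord_eq
    (fun m => if m = i then |β| / D else if m = j then |α| / D else 1 / 4) (by
      rw [huniv]
      simp only [if_true, hij.symm, hki, hkj, hli, hlj, if_false]
      field_simp
      rw [hD]; ring)
  have hxP : x ∈ interior P.body := mem_interior_body.2 fun m => by
    rw [hx]; split_ifs <;> positivity
  have hinner : ∀ y, inner ℝ v (y - s) = α * P.basis.coord i y + β * P.basis.coord j y := by
    intro y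
    rw [hv, inner_add_left, real_inner_smul_left, real_inner_smul_left, inner_grad, inner_grad, hs,
      coord_points, coord_points, if_neg hki.symm, if_neg hkj.symm, sub_zero, sub_zero]
  have hvx : inner ℝ v (x - s) = 0 := by
    rw [hinner, hx, hx, if_pos rfl, if_neg hij.symm, if_pos rfl]
    rcases mul_neg_iff.1 hneg with ⟨h1, h2⟩ | ⟨h1, h2⟩
    · rw [abs_of_pos h1, abs_of_neg h2]; ring
    · rw [abs_of_neg h1, abs_of_pos h2]; ring
  have hxQ : x ∈ interior (P.moved s (refl v)).body := mem_interior_body.2 fun m => by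
    have hc := P.coord_moved s (refl v) x m
    rw [refl_of_inner_eq_zero hvx, sub_add_cancel] at hc
    rw [hc]
    exact mem_interior_body.1 hxP m
  -- The tile and its mirror image share `x`, so the reflection permutes the vertices. It fixes `k`
  -- and `l`; fixing `i` too would put that vertex on the mirror, and swapping `i` with `j` makes
  -- two edges at `k` equal.
  obtain ⟨σ, hσ⟩ := h.exists_eq_relabel (mem_relabelings hP) hQ hxP hxQ
  have hσ' : ∀ m, P.points (σ m) = refl v (P.points m - s) + s := by
    intro m
    rw [← relabel_points, ← hσ, moved_points]
  have hfix : ∀ m, m ≠ i → m ≠ j → σ m = m := by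
    intro m hmi hmj
    apply P.independent.injective
    rw [hσ', refl_of_inner_eq_zero, sub_add_cancel]
    rw [hinner, coord_points, coord_points, if_neg hmi.symm, if_neg hmj.symm]
    simp
  have hσi : σ i = i ∨ σ i = j := by
    by_contra! hcon
    exact hcon.1 (σ.injective (hfix _ hcon.1 hcon.2))
  rcases hσi with hσi | hσi
  · have h1 := hσ' i
    rw [hσi, refl_apply, ← sub_eq_iff_eq_add, eq_comm, sub_eq_self, smul_eq_zero] at h1
    have hvi : inner ℝ v (P.points i - s) = α := by
      rw [hinner, coord_points, coord_points, if_pos rfl, if_neg hij.symm]; simp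
    have hv0 : v ≠ 0 := by
      intro h0
      rw [h0, inner_zero_left] at hvi
      exact hα hvi.symm
    have hvv : inner ℝ v v ≠ 0 := inner_self_ne_zero.2 hv0
    rcases h1 with h1 | h1
    · rw [hvi] at h1
      have := div_ne_zero hα hvv
      exact this (by linarith)
    · exact hv0 h1
  · refine hPs k i j hki hkj hij ?_
    have h1 := hσ' i
    rw [hσi] at h1
    rw [dist_comm _ (P.points j), h1, dist_eq_norm (_ + _), ← hs, add_sub_cancel_right,
      LinearIsometryEquiv.norm_map, ← dist_eq_norm, dist_comm]

/-! ### Submultiple angles -/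

/-- A consequence of the dihedral angle at the edge common to the faces opposite to `i` and `j`
being an integral part `π / n` of a straight angle, in terms of the gradients: the cosine of the
angle is nonnegative and its square is `0`, `1 / 4`, `1 / 2`, a root of `16 t ^ 2 - 12 t + 1`
exceeding `1 / 2`, or at least `3 / 4`. -/
structure SubmultipleAngle (w m : ℝ) : Prop where
  nonneg : 0 ≤ w
  sq_eq : w = 0 ∨ 4 * w ^ 2 = m ∨ 2 * w ^ 2 = m ∨
    (m < 2 * w ^ 2 ∧ 16 * w ^ 4 - 12 * w ^ 2 * m + m ^ 2 = 0) ∨ 3 * m ≤ 4 * w ^ 2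

/-- The conditions come from the first six terms of the sequence `sin (n θ) / sin θ`. -/
theorem SubmultipleAngle.of_chebyshev {c : ℝ} (h2 : 0 ≤ 2 * c)
    (h3 : 0 ≤ (4 * c ^ 2 - 1) * (2 * c))
    (h4 : 0 ≤ (8 * c ^ 3 - 4 * c) * (4 * c ^ 2 - 1))
    (h5 : 0 ≤ (16 * c ^ 4 - 12 * c ^ 2 + 1) * (8 * c ^ 3 - 4 * c))
    (h6 : 0 ≤ (32 * c ^ 5 - 32 * c ^ 3 + 6 * c) * (16 * c ^ 4 - 12 * c ^ 2 + 1)) :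
    SubmultipleAngle c 1 := by
  have hc : 0 ≤ c := by linarith
  refine ⟨hc, ?_⟩
  rcases hc.eq_or_lt with rfl | hc
  · exact Or.inl rfl
  right
  -- While a term of the sequence is positive, the next one is nonnegative. The first zero gives the
  -- angle `π / 2`, `π / 3`, `π / 4` or `π / 5`; otherwise the sixth term gives at most `π / 6`.
  have h3' : 0 ≤ 4 * c ^ 2 - 1 := nonneg_of_mul_nonneg_left h3 (by linarith)
  rcases h3'.eq_or_lt with h | h3'
  · left; linarith
  right
  have h4' : 0 ≤ 8 * c ^ 3 - 4 * c := nonneg_of_mul_nonneg_left h4 h3'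
  rw [show 8 * c ^ 3 - 4 * c = (2 * c ^ 2 - 1) * (4 * c) by ring] at h4' h5
  have h4'' : 0 ≤ 2 * c ^ 2 - 1 := nonneg_of_mul_nonneg_left h4' (by linarith)
  rcases h4''.eq_or_lt with h | h4''
  · left; linarith
  right
  have h5' : 0 ≤ 16 * c ^ 4 - 12 * c ^ 2 + 1 :=
    nonneg_of_mul_nonneg_left h5 (mul_pos h4'' (by linarith))
  rcases h5'.eq_or_lt with h | h5'
  · left; exact ⟨by linarith, by linarith⟩
  right
  have h6' := nonneg_of_mul_nonneg_left h6 h5'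
  rw [show 32 * c ^ 5 - 32 * c ^ 3 + 6 * c = (4 * c ^ 2 - 3) * ((4 * c ^ 2 - 1) * (2 * c)) by
    ring] at h6'
  have := nonneg_of_mul_nonneg_left h6' (mul_pos h3' (by linarith))
  linarith

theorem SubmultipleAngle.scale {c d : ℝ} (hd : 0 ≤ d) (h : SubmultipleAngle c 1) :
    SubmultipleAngle (c * d) (d ^ 2) := by
  obtain ⟨h0, h⟩ := h
  refine ⟨mul_nonneg h0 hd, ?_⟩
  rcases hd.eq_or_lt with rfl | hd
  · left; simp
  have hd2 : 0 < d ^ 2 := by positivity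
  rcases h with h | h | h | ⟨h, h'⟩ | h
  · left; simp [h]
  · right; left; linear_combination d ^ 2 * h
  · right; right; left; linear_combination d ^ 2 * h
  · right; right; right; left
    exact ⟨by nlinarith, by linear_combination d ^ 4 * h'⟩
  · right; right; right; right; nlinarith

/-- Reflecting the two unit normals alternately gives mirrors whose normals have consecutive terms
of the recurrence `x ↦ 2 * c * x - y` as coefficients. None cuts the tile, so consecutive terms
never have opposite signs. -/
theorem IsFaceToFaceTiling.submultipleAngle {T : Tetrahedron} {𝒯 : Set Tetrahedron}
    (h : T.IsFaceToFaceTiling 𝒯) (hT : T.FaceRigid) {P : Tetrahedron} (hP : P ∈ 𝒯)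
    (hPs : P.Scalene) {i j : Fin 4} (hij : i ≠ j) :
    SubmultipleAngle (-inner ℝ (P.grad i) (P.grad j))
      (inner ℝ (P.grad i) (P.grad i) * inner ℝ (P.grad j) (P.grad j)) := by
  obtain ⟨k, hki, hkj⟩ : ∃ k, k ≠ i ∧ k ≠ j := by decide +revert
  obtain ⟨l, hli, hlj, hkl⟩ : ∃ l, l ≠ i ∧ l ≠ j ∧ k ≠ l := by decide +revert
  set G := Subgroup.closure {refl (P.grad i), refl (P.grad j)} with hG
  have hi0 : 0 < ‖P.grad i‖ := norm_pos_iff.2 (P.grad_ne_zero i)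
  have hj0 : 0 < ‖P.grad j‖ := norm_pos_iff.2 (P.grad_ne_zero j)
  set u := ‖P.grad i‖⁻¹ • P.grad i with hu
  set v := ‖P.grad j‖⁻¹ • P.grad j with hv
  have hu1 : inner ℝ u u = 1 := by
    rw [hu, real_inner_smul_left, real_inner_smul_right, real_inner_self_eq_norm_sq]
    field_simp
  have hv1 : inner ℝ v v = 1 := by
    rw [hv, real_inner_smul_left, real_inner_smul_right, real_inner_self_eq_norm_sq]
    field_simp
  set c := -inner ℝ u v with hc
  have huv : inner ℝ u v = -c := by rw [hc, neg_neg]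
  have hvu : inner ℝ v u = -c := by rw [real_inner_comm, huv]
  clear_value c u v
  have huG : refl u ∈ G := by
    rw [hu, refl_smul (inv_ne_zero hi0.ne')]
    exact Subgroup.subset_closure (by simp)
  have hvG : refl v ∈ G := by
    rw [hv, refl_smul (inv_ne_zero hj0.ne')]
    exact Subgroup.subset_closure (by simp)
  have hconj : ∀ x y, refl x ∈ G → refl y ∈ G → refl (refl x y) ∈ G := by
    intro x y hx hy
    rw [refl_conj]
    exact G.mul_mem (G.mul_mem hx hy) (G.inv_mem hx)
  have hstep : ∀ a b : ℝ, refl (a • u + b • v) ∈ G ∧ refl (b • u + a • v) ∈ G →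
      refl ((2 * c * a - b) • u + a • v) ∈ G ∧ refl (a • u + (2 * c * a - b) • v) ∈ G := by
    rintro a b ⟨h1, h2⟩
    have e1 : refl u (b • u + a • v) = (2 * c * a - b) • u + a • v := by
      rw [refl_apply, inner_add_right, real_inner_smul_right, real_inner_smul_right, hu1, huv]
      module
    have e2 : refl v (a • u + b • v) = a • u + (2 * c * a - b) • v := by
      rw [refl_apply, inner_add_right, real_inner_smul_right, real_inner_smul_right, hv1, hvu]
      module
    exact ⟨e1 ▸ hconj _ _ huG h2, e2 ▸ hconj _ _ hvG h1⟩
  have hsign : ∀ a b : ℝ, refl (a • u + b • v) ∈ G → 0 ≤ a * b := by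
    intro a b hab
    have hab' := h.mul_nonneg_of_refl_mem hT hP hPs hij hki hkj hli hlj hkl
      (α := a * ‖P.grad i‖⁻¹) (β := b * ‖P.grad j‖⁻¹) (by
        rw [mul_smul, mul_smul, ← hu, ← hv]
        exact hab)
    have hpos : 0 < ‖P.grad i‖⁻¹ * ‖P.grad j‖⁻¹ := by positivity
    refine nonneg_of_mul_nonneg_left (b := ‖P.grad i‖⁻¹ * ‖P.grad j‖⁻¹) ?_ hpos
    linarith
  have q1 : refl ((1 : ℝ) • u + (0 : ℝ) • v) ∈ G ∧ refl ((0 : ℝ) • u + (1 : ℝ) • v) ∈ G := by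
    simpa using And.intro huG hvG
  have q2 := hstep _ _ q1
  have q3 := hstep _ _ q2
  have q4 := hstep _ _ q3
  have q5 := hstep _ _ q4
  have q6 := hstep _ _ q5
  have hangle : SubmultipleAngle c 1 := by
    refine SubmultipleAngle.of_chebyshev ?_ ?_ ?_ ?_ ?_
    · linarith [hsign _ _ q2.1]
    · linarith [hsign _ _ q3.1]
    · linarith [hsign _ _ q4.1]
    · linarith [hsign _ _ q5.1]
    · linarith [hsign _ _ q6.1]
  have := hangle.scale (mul_nonneg hi0.le hj0.le)
  convert this using 1
  · rw [hc, hu, hv, real_inner_smul_left, real_inner_smul_right]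
    field_simp
  · rw [real_inner_self_eq_norm_sq, real_inner_self_eq_norm_sq]
    ring

/-- An angle of this kind that is not right is at most `π / 3`. -/
theorem SubmultipleAngle.le_four_mul_sq {w m : ℝ} (h : SubmultipleAngle w m) (hw : 0 < w) :
    m ≤ 4 * w ^ 2 := by
  have := pow_pos hw 2
  rcases h.sq_eq with h | h | h | ⟨h, -⟩ | h
  · exact absurd h hw.ne'
  all_goals linarith

/-! ### Conductances and edge lengths -/

/-- The negatives of the inner products of the gradients of the barycentric coordinates, viewed as
conductances between the vertices; squared edge lengths are then effective resistances. -/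
noncomputable def conductance (T : Tetrahedron) (i j : Fin 4) : ℝ :=
  -inner ℝ (T.grad i) (T.grad j)

theorem conductance_comm (T : Tetrahedron) (i j : Fin 4) :
    T.conductance i j = T.conductance j i := by
  rw [conductance, conductance, real_inner_comm]

/-- The sum of the conductances at a vertex. -/
noncomputable def degree (T : Tetrahedron) (i : Fin 4) : ℝ := inner ℝ (T.grad i) (T.grad i)

theorem degree_pos (T : Tetrahedron) (i : Fin 4) : 0 < T.degree i :=
  real_inner_self_pos.2 (T.grad_ne_zero i)

/-- Any two faces meet at an angle satisfying the conditions `SubmultipleAngle`. -/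
def Coxeter (T : Tetrahedron) : Prop :=
  ∀ i j, i ≠ j → SubmultipleAngle (T.conductance i j) (T.degree i * T.degree j)

/-- The four indices are distinct. -/
def Distinct (i j k l : Fin 4) : Prop := [i, j, k, l].Nodup

instance (i j k l : Fin 4) : Decidable (Distinct i j k l) := by
  unfold Distinct; infer_instance

theorem Distinct.sum_eq {M : Type*} [AddCommMonoid M] {i j k l : Fin 4} (h : Distinct i j k l)
    (f : Fin 4 → M) : ∑ m, f m = f i + f j + f k + f l := by
  have huniv : (Finset.univ : Finset (Fin 4)) = {i, j, k, l} := by decide +revert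
  simp only [Distinct, List.nodup_cons, List.mem_cons, List.not_mem_nil, or_false, not_or] at h
  rw [huniv, Finset.sum_insert (by simp [h]), Finset.sum_insert (by simp [h]),
    Finset.sum_insert (by simp [h]), Finset.sum_singleton]
  simp only [add_assoc]

theorem Distinct.ne {i j k l : Fin 4} (h : Distinct i j k l) :
    i ≠ j ∧ i ≠ k ∧ i ≠ l ∧ j ≠ k ∧ j ≠ l ∧ k ≠ l := by
  decide +revert

theorem Distinct.swap₁₂ {i j k l : Fin 4} (h : Distinct i j k l) : Distinct j i k l := by
  decide +revert

theorem Distinct.swap₂₃ {i j k l : Fin 4} (h : Distinct i j k l) : Distinct i k j l := by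
  decide +revert

theorem Distinct.swap₃₄ {i j k l : Fin 4} (h : Distinct i j k l) : Distinct i j l k := by
  decide +revert

theorem degree_eq (T : Tetrahedron) {i j k l : Fin 4} (h : Distinct i j k l) :
    T.degree i = T.conductance i j + T.conductance i k + T.conductance i l := by
  have h1 := h.sum_eq T.grad
  rw [sum_grad] at h1
  have h2 : inner ℝ (T.grad i) (T.grad i + T.grad j + T.grad k + T.grad l) = 0 := by
    rw [← h1, inner_zero_right]
  simp only [inner_add_right] at h2
  simp only [degree, conductance]
  linarith

/-- Both sides have the same inner products with all gradients, and these span space. -/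
theorem grad_eq (T : Tetrahedron) {i j k l : Fin 4} (h : Distinct i j k l) :
    T.grad i = T.conductance i j • (T.points i - T.points j) +
      T.conductance i k • (T.points i - T.points k) +
      T.conductance i l • (T.points i - T.points l) := by
  refine T.ext_inner_grad fun m => ?_
  obtain ⟨hij, hik, hil, hjk, hjl, hkl⟩ := h.ne
  simp only [inner_add_right, real_inner_smul_right, inner_grad_points]
  have hd := T.degree_eq h
  simp only [degree] at hd
  have hm : m = i ∨ m = j ∨ m = k ∨ m = l := by
    clear hd hij hik hil hjk hjl hkl
    decide +revert
  rcases hm with rfl | rfl | rfl | rfl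
  · rw [hd]; simp [hij, hik, hil]
  · simp [hij.symm, hjk, hjl, conductance, real_inner_comm]
  · simp [hik.symm, hjk.symm, hkl, conductance, real_inner_comm]
  · simp [hil.symm, hjl.symm, hkl.symm, conductance, real_inner_comm]

theorem inner_sub_self_eq_dist_sq (x y : Space3) : inner ℝ (x - y) (x - y) = dist x y ^ 2 := by
  rw [real_inner_self_eq_norm_sq, dist_eq_norm]

theorem conductance_mul_dist_sq_of_leaf (T : Tetrahedron) {i j k l : Fin 4}
    (h : Distinct i j k l) (hik : T.conductance i k = 0) (hil : T.conductance i l = 0) :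
    T.conductance i j * dist (T.points i) (T.points j) ^ 2 = 1 := by
  have hg := T.grad_eq h
  rw [hik, hil, zero_smul, zero_smul, add_zero, add_zero] at hg
  rw [← inner_sub_self_eq_dist_sq, ← real_inner_smul_left, ← hg, inner_grad_points]
  simp [h.ne.1]

/-- Adding the gradients at `i` and `j` cancels the current in the edge between them and leaves only
the bridge. -/
theorem conductance_mul_dist_sq_of_bridge (T : Tetrahedron) {i j k l : Fin 4}
    (h : Distinct i j k l) (hik : T.conductance i k = 0) (hil : T.conductance i l = 0)
    (hjl : T.conductance j l = 0) :
    T.conductance j k * dist (T.points j) (T.points k) ^ 2 = 1 := by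
  have hg := T.grad_eq h
  have h' : Distinct j k i l := h.swap₁₂.swap₂₃
  have hg' := T.grad_eq h'
  rw [hik, hil, zero_smul, zero_smul, add_zero, add_zero] at hg
  rw [hjl, zero_smul, add_zero, T.conductance_comm j i] at hg'
  have hsum : T.grad i + T.grad j = T.conductance j k • (T.points j - T.points k) := by
    rw [hg, hg']; module
  rw [← inner_sub_self_eq_dist_sq, ← real_inner_smul_left, ← hsum, inner_add_left,
    inner_grad_points, inner_grad_points]
  simp [h.ne.1, h.ne.2.1, h.ne.2.2.2.1]

/-! ### Exclusion of the possible networks -/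

section Coxeter

variable {T : Tetrahedron} {i j k l : Fin 4}

/-- The three angle bounds multiply to `A * B * C ≤ 8 * (a * b * c)`, while `(a + c) * (a + b) * (c
+ b)` is at least the right side. -/
theorem Coxeter.false_of_triangle (hc : T.Coxeter) (h : Distinct i j k l)
    (hij : 0 < T.conductance i j) (hjk : 0 < T.conductance j k) (hik : 0 < T.conductance i k) :
    False := by
  obtain ⟨nij, nik, nil, njk, njl, nkl⟩ := h.ne
  have di := T.degree_eq h
  have dj := T.degree_eq h.swap₁₂
  have dk := T.degree_eq h.swap₂₃.swap₁₂
  have dl := T.degree_eq h.swap₃₄.swap₂₃.swap₁₂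
  have pl := T.degree_pos l
  rw [T.conductance_comm j i] at dj
  rw [T.conductance_comm k i, T.conductance_comm k j] at dk
  rw [T.conductance_comm l i, T.conductance_comm l j, T.conductance_comm l k] at dl
  have e1 := (hc i j nij).le_four_mul_sq hij
  have e2 := (hc j k njk).le_four_mul_sq hjk
  have e3 := (hc i k nik).le_four_mul_sq hik
  have x0 := (hc i l nil).nonneg
  have y0 := (hc j l njl).nonneg
  have z0 := (hc k l nkl).nonneg
  have pi := T.degree_pos i
  have pj := T.degree_pos j
  have pk := T.degree_pos k
  set a := T.conductance i j
  set b := T.conductance j k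
  set c := T.conductance i k
  set x := T.conductance i l
  set y := T.conductance j l
  set z := T.conductance k l
  set A := T.degree i
  set B := T.degree j
  set C := T.degree k
  have hsq : (A * B * C) ^ 2 ≤ (8 * (a * b * c)) ^ 2 := by
    have h1 : (A * B) * (B * C) * (A * C) ≤ (4 * a ^ 2) * (4 * b ^ 2) * (4 * c ^ 2) := by gcongr
    nlinarith
  have hle : A * B * C ≤ 8 * (a * b * c) := le_of_sq_le_sq hsq (by positivity)
  have hamgm : 8 * (a * b * c) ≤ (a + c) * (a + b) * (c + b) := by
    nlinarith [mul_nonneg hij.le (sq_nonneg (b - c)), mul_nonneg hjk.le (sq_nonneg (a - c)),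
      mul_nonneg hik.le (sq_nonneg (a - b))]
  have hA : a + c ≤ A := by linarith
  have hB : a + b ≤ B := by linarith
  have hC : c + b ≤ C := by linarith
  have h1 : (a + c) * (a + b) * (c + b) ≤ A * B * C := by gcongr
  -- The degree of `l` is positive, so one of `x`, `y`, `z` is, and the comparison is strict.
  have hlt : (a + c) * (a + b) * (c + b) < A * B * C := by
    have hAB : (a + c) * (a + b) ≤ A * B := by gcongr
    rcases x0.lt_or_eq with hx | hx
    · exact mul_lt_mul (mul_lt_mul (by linarith) hB (by positivity) pi.le) hC (by positivity)
        (by positivity)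
    rcases y0.lt_or_eq with hy | hy
    · exact mul_lt_mul (mul_lt_mul' hA (by linarith) (by positivity) pi) hC (by positivity)
        (by positivity)
    · exact mul_lt_mul' hAB (by linarith) (by positivity) (by positivity)
  linarith

theorem degree_of_leaf (h : Distinct i j k l) (hjk : T.conductance j k = 0)
    (hjl : T.conductance j l = 0) : T.degree j = T.conductance i j := by
  have dj := T.degree_eq h.swap₁₂
  rw [hjk, hjl, add_zero, add_zero, T.conductance_comm j i] at dj
  exact dj

theorem Coxeter.four_mul_eq_of_leaf (hc : T.Coxeter) (h : Distinct i j k l)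
    (hij : 0 < T.conductance i j) (hjk : T.conductance j k = 0) (hjl : T.conductance j l = 0) :
    4 * T.conductance i j = T.degree i ∨ T.degree i ≤ 2 * T.conductance i j := by
  have dj := degree_of_leaf h hjk hjl
  have hs := (hc i j h.ne.1).sq_eq
  rw [dj] at hs
  set a := T.conductance i j
  set A := T.degree i
  rcases hs with h | h | h | ⟨h, -⟩ | h
  · exact absurd h hij.ne'
  · left
    exact mul_right_cancel₀ hij.ne' (by linarith)
  all_goals
    right
    refine le_of_mul_le_mul_right ?_ hij
    nlinarith

theorem dist_eq_of_mul_sq_eq_one {a x y : ℝ} (hx : 0 ≤ x) (hy : 0 ≤ y) (h1 : a * x ^ 2 = 1)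
    (h2 : a * y ^ 2 = 1) : x = y := by
  have ha : a ≠ 0 := by rintro rfl; simp at h1
  exact (pow_left_inj₀ hx hy two_ne_zero).1 (mul_left_cancel₀ ha (h1.trans h2.symm))

/-- Each leaf carries a quarter or at least half of the central degree. Of three leaves two fall
into the same class: two quarters mean equal edges, two halves leave nothing for the third leaf. -/
theorem Coxeter.false_of_star (hc : T.Coxeter) (hs : T.Scalene) (h : Distinct i j k l)
    (hij : 0 < T.conductance i j) (hik : 0 < T.conductance i k) (hil : 0 < T.conductance i l) :
    False := by
  obtain ⟨nij, nik, nil, njk, njl, nkl⟩ := h.ne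
  have hikjl : Distinct i k j l := h.swap₂₃
  have hiljk : Distinct i l j k := h.swap₃₄.swap₂₃
  have zjk : T.conductance j k = 0 := by
    by_contra hne
    exact hc.false_of_triangle h hij ((hc j k njk).nonneg.lt_of_ne' hne) hik
  have zjl : T.conductance j l = 0 := by
    by_contra hne
    exact hc.false_of_triangle h.swap₃₄ hij
      ((hc j l njl).nonneg.lt_of_ne' hne) hil
  have zkl : T.conductance k l = 0 := by
    by_contra hne
    exact hc.false_of_triangle h.swap₂₃.swap₃₄ hik
      ((hc k l nkl).nonneg.lt_of_ne' hne) hil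
  have zkj := zjk
  have zlj := zjl
  have zlk := zkl
  rw [T.conductance_comm] at zkj zlj zlk
  have rj := T.conductance_mul_dist_sq_of_leaf
    h.swap₁₂ zjk zjl
  have rk := T.conductance_mul_dist_sq_of_leaf
    h.swap₂₃.swap₁₂ zkj zkl
  have rl := T.conductance_mul_dist_sq_of_leaf
    h.swap₃₄.swap₂₃.swap₁₂ zlj zlk
  rw [T.conductance_comm, dist_comm] at rj rk rl
  have ejk : T.conductance i j ≠ T.conductance i k := fun e =>
    hs i j k nij nik njk (dist_eq_of_mul_sq_eq_one dist_nonneg dist_nonneg rj (e ▸ rk))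
  have ejl : T.conductance i j ≠ T.conductance i l := fun e =>
    hs i j l nij nil njl (dist_eq_of_mul_sq_eq_one dist_nonneg dist_nonneg rj (e ▸ rl))
  have ekl : T.conductance i k ≠ T.conductance i l := fun e =>
    hs i k l nik nil nkl (dist_eq_of_mul_sq_eq_one dist_nonneg dist_nonneg rk (e ▸ rl))
  have di := T.degree_eq h
  rcases hc.four_mul_eq_of_leaf h hij zjk zjl with h1 | h1 <;>
  rcases hc.four_mul_eq_of_leaf hikjl hik zkj zkl with h2 | h2 <;>
  rcases hc.four_mul_eq_of_leaf hiljk hil zlj zlk with h3 | h3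
  · exact ejk (by linarith)
  · exact ejk (by linarith)
  · exact ejl (by linarith)
  · linarith
  · exact ekl (by linarith)
  all_goals linarith

/-- The possible ratios of the conductances at the inner vertex `j` of a path `i, j, k`. -/
theorem Coxeter.ratio_of_path (hc : T.Coxeter) (h : Distinct i j k l)
    (hij : 0 < T.conductance i j) (zik : T.conductance i k = 0)
    (zil : T.conductance i l = 0) (zjl : T.conductance j l = 0)
    (hne : T.conductance i j ≠ T.conductance j k) :
    3 * T.conductance i j = T.conductance j k ∨
      (T.conductance j k < T.conductance i j ∧ 5 * T.conductance i j ^ 2 -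
        10 * T.conductance i j * T.conductance j k + T.conductance j k ^ 2 = 0) ∨
      3 * T.conductance j k ≤ T.conductance i j := by
  have h' : Distinct j i k l := h.swap₁₂
  have di := degree_of_leaf h' zik zil
  have dj := T.degree_eq h'
  rw [T.conductance_comm j i] at di dj
  rw [zjl, add_zero] at dj
  have hs := (hc i j h.ne.1).sq_eq
  rw [di, dj] at hs
  set a := T.conductance i j
  set b := T.conductance j k
  rcases hs with h | h | h | ⟨h, h'⟩ | h
  · exact absurd h hij.ne'
  · left
    exact mul_left_cancel₀ hij.ne' (by linarith)
  · exact absurd (mul_left_cancel₀ hij.ne' (by linarith)) hne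
  · right; left
    refine ⟨lt_of_mul_lt_mul_left (a := a) (by linarith) hij.le, ?_⟩
    exact mul_left_cancel₀ (pow_pos hij 2).ne' (by linear_combination h')
  · right; right
    exact le_of_mul_le_mul_left (a := a) (by linarith) hij

/-- The squared cosine of the middle angle is `b ^ 2 / ((a + b) * (b + c))`. It is below `1 / 4` if
both ratios exceed `1`, and `9 / 16` if both are `1 / 3`; the mixed case either falls below `1 / 4`
or lies strictly between `1 / 4` and `1 / 2`. None is admissible. -/
theorem false_of_path_ratio {a b c : ℝ} (hb : 0 < b) (ha : 0 < a) (hc : 0 < c)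
    (h1 : 3 * a = b ∨ (b < a ∧ 5 * a ^ 2 - 10 * a * b + b ^ 2 = 0) ∨ 3 * b ≤ a)
    (h2 : 3 * c = b ∨ (b < c ∧ 5 * c ^ 2 - 10 * c * b + b ^ 2 = 0) ∨ 3 * b ≤ c)
    (hs : SubmultipleAngle b ((a + b) * (b + c))) : False := by
  have hle := hs.le_four_mul_sq hb
  have hq := hs.sq_eq
  have big : ∀ {x y : ℝ}, b < x → b < y → ¬ (x + b) * (b + y) ≤ 4 * b ^ 2 := by
    intro x y hx hy hle
    nlinarith [mul_pos (sub_pos.2 hx) (sub_pos.2 hy)]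
  -- one ratio is `1 / 3`, the other one is close to `2`
  have mixed : ∀ {x : ℝ}, b < x → (5 * x ^ 2 - 10 * x * b + b ^ 2 = 0 ∨ 3 * b ≤ x) →
      ∀ m, m = (x + b) * (b + b / 3) → SubmultipleAngle b m → False := by
    intro x hx hx' m hm hs
    have hle := hs.le_four_mul_sq hb
    have hlt : x ≤ 2 * b := by
      have : b * x ≤ b * (2 * b) := by nlinarith
      exact le_of_mul_le_mul_left this hb
    rcases hx' with hx' | hx'
    · rcases hs.sq_eq with h | h | h | ⟨h, -⟩ | h
      · exact hb.ne' h
      · have : x = 2 * b := mul_left_cancel₀ hb.ne' (by nlinarith)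
        rw [this] at hx'
        nlinarith [pow_pos hb 2]
      all_goals nlinarith [pow_pos hb 2, mul_pos hb (sub_pos.2 hx)]
    · linarith
  have c1 : ∀ {x : ℝ}, ((b < x ∧ 5 * x ^ 2 - 10 * x * b + b ^ 2 = 0) ∨ 3 * b ≤ x) →
      b < x ∧ (5 * x ^ 2 - 10 * x * b + b ^ 2 = 0 ∨ 3 * b ≤ x) := by
    rintro x (⟨h, h'⟩ | h)
    · exact ⟨h, Or.inl h'⟩
    · exact ⟨by linarith, Or.inr h⟩
  rcases h1 with h1 | h1 <;> rcases h2 with h2 | h2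
  · obtain rfl : a = b / 3 := by linarith
    obtain rfl : c = b / 3 := by linarith
    have hb2 := pow_pos hb 2
    have hb4 := pow_pos hb 4
    rcases hq with h | h | h | ⟨h, h'⟩ | h <;> nlinarith
  · obtain rfl : a = b / 3 := by linarith
    exact mixed (c1 h2).1 (c1 h2).2 _ (by ring) hs
  · obtain rfl : c = b / 3 := by linarith
    exact mixed (c1 h1).1 (c1 h1).2 _ rfl hs
  · exact big (c1 h1).1 (c1 h2).1 hle

theorem Coxeter.false_of_path (hc : T.Coxeter) (hs : T.Scalene) (h : Distinct i j k l)
    (hij : 0 < T.conductance i j) (hjk : 0 < T.conductance j k) (hkl : 0 < T.conductance k l)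
    (zik : T.conductance i k = 0) (zil : T.conductance i l = 0) (zjl : T.conductance j l = 0) :
    False := by
  obtain ⟨nij, nik, nil, njk, njl, nkl⟩ := h.ne
  have h' : Distinct l k j i := h.swap₁₂.swap₂₃.swap₃₄.swap₁₂.swap₂₃.swap₁₂
  have zli := zil
  have zlj := zjl
  have zki := zik
  rw [T.conductance_comm] at zli zlj zki
  have ri := T.conductance_mul_dist_sq_of_leaf h zik zil
  have rl := T.conductance_mul_dist_sq_of_leaf h' zlj zli
  have rjk := T.conductance_mul_dist_sq_of_bridge h zik zil zjl
  have e1 : T.conductance i j ≠ T.conductance j k := fun e =>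
    hs j i k nij.symm njk nik (dist_eq_of_mul_sq_eq_one dist_nonneg dist_nonneg
      (by rw [dist_comm]; exact e ▸ ri) rjk)
  have e2 : T.conductance l k ≠ T.conductance k j := fun e =>
    hs k l j nkl njk.symm njl.symm (dist_eq_of_mul_sq_eq_one dist_nonneg dist_nonneg
      (by rw [dist_comm]; rw [e, T.conductance_comm] at rl; exact rl)
      (by rw [dist_comm]; exact rjk))
  have q1 := hc.ratio_of_path h hij zik zil zjl e1
  have q2 := hc.ratio_of_path h' (by rwa [T.conductance_comm]) zlj zli zki e2
  rw [T.conductance_comm l k, T.conductance_comm k j] at q2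
  have dj := T.degree_eq h.swap₁₂
  have dk := T.degree_eq h.swap₁₂.swap₂₃.swap₃₄.swap₁₂
  rw [zjl, add_zero, T.conductance_comm j i] at dj
  rw [zki, add_zero, T.conductance_comm k j] at dk
  have hsub := hc j k njk
  rw [dj, dk] at hsub
  exact false_of_path_ratio hjk hij hkl q1 q2 hsub

/-- A four-cycle whose smallest conductance is that of its edge `i j`. -/
theorem Coxeter.false_of_cycle_of_le (hc : T.Coxeter) (hs : T.Scalene) (h : Distinct i j k l)
    (hij : 0 < T.conductance i j) (hjk : 0 < T.conductance j k)
    (zik : T.conductance i k = 0) (zjl : T.conductance j l = 0)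
    (h1 : T.conductance i j ≤ T.conductance j k)
    (h2 : T.conductance i j ≤ T.conductance k l)
    (h3 : T.conductance i j ≤ T.conductance l i) : False := by
  obtain ⟨nij, nik, nil, njk, njl, nkl⟩ := h.ne
  have di := T.degree_eq h
  have dj := T.degree_eq h.swap₁₂
  have dk := T.degree_eq h.swap₁₂.swap₂₃.swap₃₄.swap₁₂
  have gi := T.grad_eq h
  have gk := T.grad_eq h.swap₁₂.swap₂₃.swap₃₄.swap₁₂
  rw [zik, add_zero, T.conductance_comm i l] at di
  rw [zjl, add_zero, T.conductance_comm j i] at dj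
  rw [T.conductance_comm k i, zik, add_zero, T.conductance_comm k j] at dk
  rw [zik, T.conductance_comm i l] at gi
  rw [T.conductance_comm k i, zik, T.conductance_comm k j] at gk
  have e1 := (hc i j nij).le_four_mul_sq hij
  have e2 := (hc j k njk).le_four_mul_sq hjk
  rw [di, dj] at e1
  rw [dj, dk] at e2
  have hinn : inner ℝ (T.grad i - T.grad k)
      ((T.points i - T.points j) + (T.points k - T.points j)) = 0 := by
    simp [inner_sub_left, inner_add_right, inner_grad_points, nij, nik, nik.symm, njk.symm]
  set a := T.conductance i j
  set b := T.conductance j k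
  set c := T.conductance k l
  set d := T.conductance l i
  -- Since `a` is minimal, `(a + d) * (a + b) ≤ 4 * a ^ 2` forces equality. Then all four
  -- conductances agree, the gradients at `i` and `k` differ by a multiple of the edge between these
  -- vertices, and `hinn` makes `j` equidistant from them.
  have hd : d = a := by
    refine le_antisymm (le_of_mul_le_mul_left (a := a) ?_ hij) h3
    nlinarith
  have hb : b = a := by
    refine le_antisymm (le_of_mul_le_mul_left (a := a) ?_ hij) h1
    nlinarith
  rw [hb] at e2 gk
  rw [hd] at gi
  have hca : c = a := by
    refine le_antisymm (le_of_mul_le_mul_left (a := a) ?_ hij) h2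
    nlinarith
  rw [hca] at gk
  have hg : T.grad i - T.grad k = (2 * a) • ((T.points i - T.points j) -
      (T.points k - T.points j)) := by
    rw [gi, gk]; module
  rw [hg, real_inner_smul_left, mul_eq_zero, or_iff_right (by positivity), inner_sub_left,
    inner_add_right, inner_add_right, inner_sub_self_eq_dist_sq, inner_sub_self_eq_dist_sq,
    real_inner_comm] at hinn
  refine hs j i k nij.symm njk nik ?_
  rw [dist_comm, dist_comm (T.points j)]
  exact (pow_left_inj₀ dist_nonneg dist_nonneg two_ne_zero).1 (by linarith)

theorem Coxeter.false_of_cycle (hc : T.Coxeter) (hs : T.Scalene) (h : Distinct i j k l)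
    (hij : 0 < T.conductance i j) (hjk : 0 < T.conductance j k) (hkl : 0 < T.conductance k l)
    (hli : 0 < T.conductance l i) (zik : T.conductance i k = 0) (zjl : T.conductance j l = 0) :
    False := by
  have zki := zik
  have zlj := zjl
  rw [T.conductance_comm] at zki zlj
  have r1 := fun h1 h2 h3 => hc.false_of_cycle_of_le hs h hij hjk zik zjl h1 h2 h3
  have r2 := fun h1 h2 h3 => hc.false_of_cycle_of_le hs
    h.swap₁₂.swap₂₃.swap₃₄ hjk hkl zjl zki h1 h2 h3
  have r3 := fun h1 h2 h3 => hc.false_of_cycle_of_le hs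
    h.swap₁₂.swap₂₃.swap₃₄.swap₁₂.swap₂₃.swap₃₄ hkl hli zki zlj h1 h2 h3
  have r4 := fun h1 h2 h3 => hc.false_of_cycle_of_le hs
    h.swap₃₄.swap₂₃.swap₁₂ hli hij zlj zik h1 h2 h3
  grind

/-- Without triangles and stars only the edges `k l` and `l i` remain open: both give a cycle, one
gives a path, and none would make the degree of `l` zero. -/
theorem Coxeter.false_of_two_edges (hc : T.Coxeter) (hs : T.Scalene) (h : Distinct i j k l)
    (hij : 0 < T.conductance i j) (hjk : 0 < T.conductance j k) : False := by
  obtain ⟨nij, nik, nil, njk, njl, nkl⟩ := h.ne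
  have zik : T.conductance i k = 0 := by
    by_contra hne
    exact hc.false_of_triangle h hij hjk ((hc i k nik).nonneg.lt_of_ne' hne)
  have zjl : T.conductance j l = 0 := by
    by_contra hne
    exact hc.false_of_star hs h.swap₁₂
      (by rwa [T.conductance_comm]) hjk ((hc j l njl).nonneg.lt_of_ne' hne)
  rcases (hc k l nkl).nonneg.lt_or_eq with hkl | hkl <;>
  rcases (hc l i nil.symm).nonneg.lt_or_eq with hli | hli
  · exact hc.false_of_cycle hs h hij hjk hkl hli zik zjl
  · exact hc.false_of_path hs h hij hjk hkl zik (by rw [T.conductance_comm, ← hli]) zjl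
  · exact hc.false_of_path hs h.swap₃₄.swap₂₃.swap₁₂ hli hij hjk
      (by rw [T.conductance_comm, zjl]) (by rw [T.conductance_comm, ← hkl]) zik
  · have dl := T.degree_eq h.swap₃₄.swap₂₃.swap₁₂
    rw [← hli, T.conductance_comm l j, zjl, T.conductance_comm l k, ← hkl] at dl
    have := T.degree_pos l
    linarith

/-- The three Euclidean Coxeter simplices of dimension three have isosceles faces. -/
theorem Coxeter.not_scalene (hc : T.Coxeter) : ¬ T.Scalene := by
  intro hs
  have hedge : ∀ {i j k l : Fin 4}, Distinct i j k l → ¬ 0 < T.conductance i j := by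
    intro i j k l h hij
    obtain ⟨nij, nik, nil, njk, njl, nkl⟩ := h.ne
    have hji : 0 < T.conductance j i := by rwa [T.conductance_comm]
    have zjk := (hc j k njk).nonneg.lt_or_eq.resolve_left fun hjk =>
      hc.false_of_two_edges hs h hij hjk
    have zjl := (hc j l njl).nonneg.lt_or_eq.resolve_left fun hjl =>
      hc.false_of_two_edges hs h.swap₃₄ hij hjl
    have zik := (hc i k nik).nonneg.lt_or_eq.resolve_left fun hik =>
      hc.false_of_two_edges hs h.swap₁₂ hji hik
    have zil := (hc i l nil).nonneg.lt_or_eq.resolve_left fun hil =>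
      hc.false_of_two_edges hs h.swap₁₂.swap₃₄ hji hil
    have gi := T.grad_eq h
    have gj := T.grad_eq h.swap₁₂
    rw [← zik, ← zil] at gi
    rw [← zjk, ← zjl, T.conductance_comm j i] at gj
    -- An isolated edge would make two face normals opposite, although these two faces meet.
    have hg : T.grad i + T.grad j = 0 := by rw [gi, gj]; module
    have hinn : inner ℝ (T.grad i + T.grad j) (T.points i - T.points k) = 1 := by
      simp [inner_add_left, inner_grad_points, nik, nij.symm, njk]
    simp [hg] at hinn
  have d0 := T.degree_eq (show Distinct 0 1 2 3 by decide)
  have h1 := hedge (show Distinct 0 1 2 3 by decide)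
  have h2 := hedge (show Distinct 0 2 1 3 by decide)
  have h3 := hedge (show Distinct 0 3 1 2 by decide)
  have := T.degree_pos 0
  linarith

end Coxeter

/-! ### Conclusion for the four patterns of edge lengths -/

theorem IsFaceToFaceTiling.nonempty {T : Tetrahedron} {𝒯 : Set Tetrahedron}
    (h : T.IsFaceToFaceTiling 𝒯) : 𝒯.Nonempty := by
  have h0 : (0 : Space3) ∈ ⋃ S ∈ 𝒯, S.body := h.covers ▸ Set.mem_univ _
  simp only [Set.mem_iUnion] at h0
  obtain ⟨S, hS, -⟩ := h0
  exact ⟨S, hS⟩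

theorem not_tilesFaceToFace {T : Tetrahedron} (hr : T.FaceRigid) (hs : T.Scalene) :
    ¬ T.TilesFaceToFace := by
  rintro ⟨𝒯, h⟩
  obtain ⟨P, hP⟩ := h.nonempty
  have hPs : P.Scalene := by
    intro i j k hij hik hjk
    rw [(h.copies P hP).dist_eq, (h.copies P hP).dist_eq]
    exact hs i j k hij hik hjk
  have hc : P.Coxeter := fun i j hij => h.submultipleAngle hr hP hPs hij
  exact hc.not_scalene hPs

/-- The edge lengths follow a pattern of equalities: `lab` tells the edges of different lengths
apart, up to the numbering `σ` of the vertices. -/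
theorem not_tilesFaceToFace_of_pattern {T : Tetrahedron} {n : ℕ} {val : Fin n → ℝ}
    (hval : Function.Injective val) (lab : Fin 4 → Fin 4 → Fin n) (σ : Equiv.Perm (Fin 4))
    (hd : ∀ i j, i ≠ j → dist (T.points (σ i)) (T.points (σ j)) = val (lab i j))
    (hr : ∀ (π : Equiv.Perm (Fin 4)) (i : Fin 4),
      (∀ j k, j ≠ i → k ≠ i → j ≠ k → lab (π j) (π k) = lab j k) →
      ∀ j k, j ≠ k → lab (π j) (π k) = lab j k)
    (hs : ∀ i j k, i ≠ j → i ≠ k → j ≠ k → lab i j ≠ lab i k) : ¬ T.TilesFaceToFace := by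
  have hd' : ∀ i j, i ≠ j →
      dist (T.points i) (T.points j) = val (lab (σ.symm i) (σ.symm j)) := by
    intro i j hij
    rw [← hd _ _ (σ.symm.injective.ne hij), σ.apply_symm_apply, σ.apply_symm_apply]
  refine not_tilesFaceToFace ?_ ?_
  · intro π i h j k hjk
    have := hr ((σ.trans π).trans σ.symm) (σ.symm i) (by
      intro a b ha hb hab
      have h1 := h (σ a) (σ b) (fun e => ha (by rw [← e, σ.symm_apply_apply]))
        (fun e => hb (by rw [← e, σ.symm_apply_apply])) (σ.injective.ne hab)
      rw [hd' _ _ (π.injective.ne (σ.injective.ne hab)), hd a b hab] at h1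
      exact hval h1) (σ.symm j) (σ.symm k) (σ.symm.injective.ne hjk)
    simp only [Equiv.trans_apply, σ.apply_symm_apply] at this
    rw [hd' _ _ (π.injective.ne hjk), hd' _ _ hjk, this]
  · intro i j k hij hik hjk
    rw [hd' _ _ hij, hd' _ _ hik]
    exact hval.ne (hs _ _ _ (σ.symm.injective.ne hij) (σ.symm.injective.ne hik)
      (σ.symm.injective.ne hjk))

end Tetrahedron

theorem theorem5p5 (T : Tetrahedron)
    (hT : T.IsTypeG ∨ T.IsTypeP ∨ T.IsTypeW ∨ T.IsTypeY) :
    ¬ T.TilesFaceToFace := by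
  rcases hT with ⟨a, b, c, hn, σ, h1, h2, h3, h4, h5, h6⟩ |
    ⟨a, b, c, d, hn, σ, h1, h2, h3, h4, h5, h6⟩ |
    ⟨a, b, c, d, e, hn, σ, h1, h2, h3, h4, h5, h6⟩ |
    ⟨a, b, c, d, e, f, hn, σ, h1, h2, h3, h4, h5, h6⟩
  -- Labels index the list of lengths; the diagonal zeros are placeholders, as only distinct indices
  -- are compared. Rigidity and scaleneness become finite checks over renumberings and vertices.
  · refine Tetrahedron.not_tilesFaceToFace_of_pattern (val := ![a, b, c])
      (List.nodup_ofFn.1 (by simpa using hn))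
      (![![0, 0, 1, 2], ![0, 0, 2, 1], ![1, 2, 0, 0], ![2, 1, 0, 0]]) σ ?_
      (by decide +kernel) (by decide)
    intro i j hij
    fin_cases i <;> fin_cases j <;> first | exact absurd rfl hij | assumption |
      (rw [dist_comm]; assumption)
  · refine Tetrahedron.not_tilesFaceToFace_of_pattern (val := ![a, b, c, d])
      (List.nodup_ofFn.1 (by simpa using hn))
      (![![0, 0, 2, 1], ![0, 0, 1, 3], ![2, 1, 0, 0], ![1, 3, 0, 0]]) σ ?_
      (by decide +kernel) (by decide)
    intro i j hij
    fin_cases i <;> fin_cases j <;> first | exact absurd rfl hij | assumption |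
      (rw [dist_comm]; assumption)
  · refine Tetrahedron.not_tilesFaceToFace_of_pattern (val := ![a, b, c, d, e])
      (List.nodup_ofFn.1 (by simpa using hn))
      (![![0, 1, 0, 2], ![1, 0, 3, 0], ![0, 3, 0, 4], ![2, 0, 4, 0]]) σ ?_
      (by decide +kernel) (by decide)
    intro i j hij
    fin_cases i <;> fin_cases j <;> first | exact absurd rfl hij | assumption |
      (rw [dist_comm]; assumption)
  · refine Tetrahedron.not_tilesFaceToFace_of_pattern (val := ![a, b, c, d, e, f])
      (List.nodup_ofFn.1 (by simpa using hn))
      (![![0, 0, 1, 2], ![0, 0, 3, 4], ![1, 3, 0, 5], ![2, 4, 5, 0]]) σ ?_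
      (by decide +kernel) (by decide)
    intro i j hij
    fin_cases i <;> fin_cases j <;> first | exact absurd rfl hij | assumption |
      (rw [dist_comm]; assumption)
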